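/- Let $A$ be an infinitely generated free abelian group, and let $m \ge 2$ be a natural number. Call a nonempty subset of $A$ unimodular if it can be extended to a basis of $A$, and let $\Gamma_A(m)$ denote the principal congruence subgroup of level $m$, that is, the subgroup of all $\psi \in \mathrm{Aut}(A)$ such that $\psi(a) \equiv a \pmod{mA}$ for all $a \in A$. Let $\varphi \in \mathrm{Aut}(A)$, and suppose that there is a unimodular set $\{x_i, y_i : i \in I\}$ of $A$ (the elements $x_i$, $y_i$, $i \in I$, being pairwise distinct) of cardinality $\mathrm{rank}(A)$ such that, for all $i \in I$, $$\varphi(x_i) = k_i x_i + m y_i$$ for some integers $k_i \in \mathbb{Z}$. Then the normal closure of $\varphi$ in $\mathrm{Aut}(A)$ contains the group $\Gamma_A(m)$. -/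

import Mathlib

/-- A unimodular set of an abelian group `A`: a nonempty subset which can be extended to a basis
of `A`, that is, to a linearly independent subset generating `A`. -/
def IsUnimodularSet {A : Type*} [AddCommGroup A] (S : Set A) : Prop :=
  S.Nonempty ∧ ∃ T : Set A, S ⊆ T ∧ LinearIndepOn ℤ id T ∧ Submodule.span ℤ T = ⊤

/-- The principal congruence subgroup of level `m` of `Aut A`: all automorphisms `φ` of `A` with
`φ a ≡ a (mod mA)` for every `a`. Automorphisms of the abelian group `A` are taken as
`ℤ`-linear equivalences, on which the group operation is composition. -/
def principalCongruenceSubgroup (A : Type*) [AddCommGroup A] (m : ℕ) :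
    Subgroup (A ≃ₗ[ℤ] A) where
  carrier := {φ | ∀ a : A, ∃ b : A, φ a - a = m • b}
  one_mem' := fun a => ⟨0, by simp⟩
  mul_mem' := by
    intro φ ψ hφ hψ a
    obtain ⟨b, hb⟩ := hψ a
    obtain ⟨c, hc⟩ := hφ (ψ a)
    refine ⟨c + b, ?_⟩
    rw [smul_add, ← hb, ← hc, LinearEquiv.mul_apply]
    abel
  inv_mem' := by
    intro φ hφ a
    obtain ⟨b, hb⟩ := hφ (φ⁻¹ a)
    refine ⟨-b, ?_⟩
    have h : φ (φ⁻¹ a) = a := φ.apply_symm_apply a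
    rw [h] at hb
    rw [smul_neg, ← hb]
    abel

set_option linter.unusedSimpArgs false

/-! ### Transvections and Whitehead's lemma in a ring. -/

section RingTheory

variable {R : Type*} [Ring R]

/-! Work in the ring `R = End A`, where a pair `i`, `p` with `p * i = 1` is a summand isomorphic to
`A`. Since `A` has infinite rank, `A ≅ A × A` and `A ≅ ℕ →₀ A`, so block matrices over `R` live in
`R` itself. Let `N` be the normal closure of the given automorphism, viewed among the units of `R`.

Transvections: the relation `φ x = k x + m y` on a large unimodular set produces, through two
commutators and a further combination of conjugates, all level-`m` transvections between two
particular summands with large room left over (`transvection_mem_values_of_unit`). Change of basis,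
plus cutting a summand in two to create room, yields all of them (`hasTransvections_of_room`).

Invertible blocks: by Whitehead's lemma `N` contains `diag(u, u⁻¹)` whenever `u ≡ 1` and `u⁻¹ ≡ 1`
mod `m`. An Eilenberg swindle with infinitely many copies of `u` then puts `diag(u, 1)` in `N`
(`diagonal_mem_values`).

Congruence subgroup: for `f = 1 + m g` some large summand `i` and its image under `g` both miss
another large summand `j`. Using `j` as auxiliary space, a product of elements of `N` agrees with
`f` on `i`. The quotient fixes `i`, hence is block triangular: an invertible block times a
transvection, both in `N` (`mem_values_of_eq_one_add`). -/

theorem mul_mul_of_mul_eq {a b c : R} (h : a * b = c) (t : R) : a * (b * t) = c * t := by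
  rw [← mul_assoc, h]

theorem one_add_mul_one_sub_of_mul_eq_zero {a b : R} (h : b * a = 0) :
    (1 + a * b) * (1 - a * b) = 1 := by
  have : a * b * (a * b) = 0 := by rw [mul_assoc, mul_mul_of_mul_eq h, zero_mul, mul_zero]
  rw [add_mul, one_mul, mul_sub, mul_one, this]; abel

theorem one_sub_mul_one_add_of_mul_eq_zero {a b : R} (h : b * a = 0) :
    (1 - a * b) * (1 + a * b) = 1 := by
  have : a * b * (a * b) = 0 := by rw [mul_assoc, mul_mul_of_mul_eq h, zero_mul, mul_zero]
  rw [sub_mul, one_mul, mul_add, mul_one, this]; abel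

theorem mul_eq_neg_sub_of_one_add_mul_one_add {u v : R} (h : (1 + u) * (1 + v) = 1) :
    u * v = -u - v := by
  have : 1 + (u + v + u * v) = 1 := by
    conv_rhs => rw [← h, add_mul, one_mul, mul_add, mul_one]
    abel
  rw [← sub_eq_zero, ← add_eq_left.1 this]
  abel

/-- The submonoid of the values in `R` of a subgroup of the group of units of `R`. -/
abbrev Subgroup.values (N : Subgroup Rˣ) : Submonoid R :=
  N.toSubmonoid.map (Units.coeHom R)

namespace Subgroup

variable {N : Subgroup Rˣ}

theorem coe_mem_values {u : Rˣ} : (u : R) ∈ N.values ↔ u ∈ N := by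
  simp only [Submonoid.mem_map, Subgroup.mem_toSubmonoid, Units.coeHom_apply]
  exact ⟨fun ⟨v, hv, h⟩ => Units.ext h ▸ hv, fun h => ⟨u, h, rfl⟩⟩

theorem mem_values_of_mul_eq_one {f g : R} (hf : f ∈ N.values) (h : f * g = 1) :
    g ∈ N.values := by
  obtain ⟨u, hu, rfl⟩ := hf
  rw [Units.coeHom_apply, Units.mul_eq_one_iff_inv_eq] at h
  exact h ▸ coe_mem_values.2 (N.inv_mem hu)

theorem conj_mem_values [N.Normal] {a b f : R} (hab : a * b = 1) (hba : b * a = 1)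
    (hf : f ∈ N.values) : a * f * b ∈ N.values := by
  obtain ⟨u, hu, rfl⟩ := hf
  exact ⟨⟨a, b, hab, hba⟩ * u * ⟨a, b, hab, hba⟩⁻¹, ‹N.Normal›.conj_mem u hu _, rfl⟩

/-- A group of units contains all transvections `1 + m • (i * h * p)` of level `m`, where `i` and
`p` are the injection and the projection of different summands of a decomposition. -/
def HasTransvections (N : Subgroup Rˣ) (m : ℕ) : Prop :=
  ∀ i p p' i' h : R, p * i = 0 → p' * i = 1 → p * i' = 1 → 1 + m • (i * h * p) ∈ N.values

/-- Transvections obtained from a unit `f` by two successive commutators and a conjugation. -/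
theorem transvection_mem_values_of_unit [N.Normal] {m : ℕ} {f f' x₁ x₂ z z' q c : R}
    (hf : f ∈ N.values) (hff : f * f' = 1) (hff' : f' * f = 1)
    (hqx₁ : q * x₁ = 0) (hqx₂ : q * x₂ = 0) (hqz : q * z = 0)
    (hqfx₁ : q * (f * x₁) = 0) (hqfx₂ : q * (f * x₂) = m • (1 : R))
    (hz : z' * z = 1) (hzx₁ : z' * (f * x₁) = 0)
    (hcx₁ : c * (f * x₁) = 0) (hcx₂ : c * (f * x₂) = 0) (h : R) :
    1 + m • (f * x₁ * h * c) ∈ N.values := by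
  have hf' : f' ∈ N.values := mem_values_of_mul_eq_one hf hff
  have r1 := mul_mul_of_mul_eq hqx₁
  have r2 := mul_mul_of_mul_eq hqx₂
  have hσ : (1 + z * q) * (1 - z * q) = 1 :=
    one_add_mul_one_sub_of_mul_eq_zero hqz
  have hσ' : (1 - z * q) * (1 + z * q) = 1 :=
    one_sub_mul_one_add_of_mul_eq_zero hqz
  -- The commutator of `1 + z * q` with `f`: it fixes `f * x₁` and moves `f * x₂` by `m • z`,
  -- because `q` reads off the coefficient `m`.
  obtain ⟨θ, hθ⟩ : ∃ θ, θ = (1 + z * q) * f * (1 - z * q) * f' := ⟨_, rfl⟩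
  obtain ⟨θ', hθ'⟩ : ∃ θ', θ' = f * (1 + z * q) * f' * (1 - z * q) := ⟨_, rfl⟩
  have hθmem : θ ∈ N.values := hθ ▸ mul_mem (conj_mem_values hσ hσ' hf) hf'
  have hθθ : θ' * θ = 1 := by
    rw [hθ, hθ', show f * (1 + z * q) * f' * (1 - z * q) * ((1 + z * q) * f * (1 - z * q) * f')
      = f * (1 + z * q) * f' * ((1 - z * q) * (1 + z * q)) * f * (1 - z * q) * f' by
        simp only [mul_assoc], hσ', mul_one, mul_assoc _ f' f, hff', mul_one,
        mul_assoc f, hσ, mul_one, hff]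
  have hθx₁ : θ * (f * x₁) = f * x₁ := by
    rw [hθ]
    simp only [mul_add, add_mul, mul_sub, sub_mul, mul_one, one_mul, mul_assoc,
      mul_mul_of_mul_eq hff', hqx₁, hqfx₁, mul_zero]; abel
  have hθx₂ : θ * (f * x₂) = f * x₂ + m • z := by
    rw [hθ]
    simp only [mul_add, add_mul, mul_sub, sub_mul, mul_one, one_mul, mul_assoc,
      mul_mul_of_mul_eq hff', hqx₂, hqfx₂, mul_zero, mul_smul_comm]; abel
  have hθ'x₁ : θ' * (f * x₁) = f * x₁ := by
    conv_lhs => rw [← hθx₁]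
    rw [← mul_assoc, hθθ, one_mul]
  have hθ'mem : θ' ∈ N.values := by
    obtain ⟨u, hu, rfl⟩ := hθmem
    rw [Units.coeHom_apply, Units.mul_eq_one_iff_eq_inv] at hθθ
    exact hθθ ▸ coe_mem_values.2 (N.inv_mem hu)
  generalize hX : f * x₁ = X at *
  generalize hY : f * x₂ = Y at *
  have r4 := mul_mul_of_mul_eq hzx₁
  have r5 := mul_mul_of_mul_eq hθx₁
  have r6 := mul_mul_of_mul_eq hθ'x₁
  have r7 := mul_mul_of_mul_eq hcx₁
  have r8 := mul_mul_of_mul_eq hcx₂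
  have r9 := mul_mul_of_mul_eq hθx₂
  -- The commutator of `1 + X * k * z'` with `θ'`, simplified because `θ'` fixes `X` and `z' * X =
  -- 0`.
  have key : ∀ k : R, 1 + X * k * z' * (1 - θ) ∈ N.values := by
    intro k
    have e1 : (1 + X * k * z') * (1 - X * k * z') = 1 :=
    one_add_mul_one_sub_of_mul_eq_zero (show z' * (X * k) = 0 by rw [r4, zero_mul])
    have e2 : (1 - X * k * z') * (1 + X * k * z') = 1 :=
    one_sub_mul_one_add_of_mul_eq_zero (show z' * (X * k) = 0 by rw [r4, zero_mul])
    have := mul_mem (conj_mem_values e1 e2 hθ'mem) hθmem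
    convert this using 1
    simp only [mul_add, add_mul, mul_sub, sub_mul, mul_one, one_mul, mul_assoc, r4, r6, hθθ,
      zero_mul, mul_zero]; abel
  -- The unwanted part of `key h` cancels against its inverse `key (-h)` conjugated by `1 - Y * c`;
  -- since `z' * (1 - θ) * Y = -m`, only `m • (X * h * c)` survives.
  have e1 : (1 - Y * c) * (1 + Y * c) = 1 :=
    one_sub_mul_one_add_of_mul_eq_zero hcx₂
  have e2 : (1 + Y * c) * (1 - Y * c) = 1 :=
    one_add_mul_one_sub_of_mul_eq_zero hcx₂
  have := mul_mem (key h) (conj_mem_values e1 e2 (key (-h)))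
  convert this using 1
  simp only [mul_add, add_mul, mul_sub, sub_mul, mul_one, one_mul, mul_assoc, r4, r5, r6, r7, r8,
    r9, neg_mul, mul_neg, zero_mul, mul_zero, hcx₁, hcx₂, smul_mul_assoc, mul_smul_comm,
    mul_mul_of_mul_eq hz]
  abel_nf

/-- Whitehead's lemma: a unit `1 + m • a` at one summand together with its inverse at another is a
product of conjugates of transvections. -/
theorem whitehead_mem_values [N.Normal] {m : ℕ} (hN : N.HasTransvections m)
    {i p i' p' a b : R} (hpi : p * i = 1) (hpi' : p' * i' = 1) (h₁ : p * i' = 0)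
    (h₂ : p' * i = 0) (hab : (1 + m • a) * (1 + m • b) = 1)
    (hba : (1 + m • b) * (1 + m • a) = 1) :
    1 + m • (i * a * p) + m • (i' * b * p') ∈ N.values := by
  generalize hA : m • a = u at *
  generalize hB : m • b = v at *
  have ha : 1 + i * u * p' ∈ N.values := by
    simpa only [← hA, mul_smul_comm, smul_mul_assoc] using hN i p' p i' a h₂ hpi hpi'
  have hb : 1 - i' * v * p ∈ N.values := by
    simpa only [← hB, mul_smul_comm, smul_mul_assoc, sub_eq_add_neg, mul_neg, neg_mul, smul_neg]
      using      hN i' p p' i (-b) h₁ hpi' hpi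
  have r1 := mul_mul_of_mul_eq hpi
  have r2 := mul_mul_of_mul_eq hpi'
  have r3 := mul_mul_of_mul_eq h₁
  have r4 := mul_mul_of_mul_eq h₂
  have e1 : (1 - i' * p) * (1 + i' * p) = 1 :=
    one_sub_mul_one_add_of_mul_eq_zero h₁
  have e2 : (1 + i' * p) * (1 - i' * p) = 1 :=
    one_add_mul_one_sub_of_mul_eq_zero h₁
  have e3 : (1 + i * p') * (1 - i * p') = 1 :=
    one_add_mul_one_sub_of_mul_eq_zero h₂
  have e4 : (1 - i * p') * (1 + i * p') = 1 :=
    one_sub_mul_one_add_of_mul_eq_zero h₂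
  have := conj_mem_values e3 e4 (mul_mem ha (conj_mem_values e1 e2 (mul_mem hb ha)))
  convert this using 1
  have huv := mul_eq_neg_sub_of_one_add_mul_one_add hab
  have hvu := mul_eq_neg_sub_of_one_add_mul_one_add hba
  rw [← smul_mul_assoc, ← mul_smul_comm, hA, ← smul_mul_assoc, ← mul_smul_comm, hB]
  simp only [mul_add, add_mul, mul_sub, sub_mul, mul_one, one_mul, mul_assoc, r1, r2, r3, r4,
    zero_mul, mul_zero, mul_mul_of_mul_eq huv, mul_mul_of_mul_eq hvu, neg_mul, mul_neg]
  abel_nf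

end Subgroup

end RingTheory

/-! ### Submodules of free modules over a principal ideal domain. -/

section FreeSubmodule

variable {R : Type*} [CommRing R] [IsDomain R] [IsPrincipalIdealRing R]

omit [IsPrincipalIdealRing R] in
-- In a vanishing combination, the term with the largest leading position is alone at that
-- coordinate.
theorem linearIndependent_of_triangular {E J : Type*} [LinearOrder E] (f : J → E)
    (hf : Function.Injective f) (v : J → E →₀ R) (hv : ∀ j, v j (f j) ≠ 0)
    (hvs : ∀ j e, f j < e → v j e = 0) : LinearIndependent R v := by
  refine linearIndependent_iff.2 fun c hc => ?_
  by_contra hne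
  obtain ⟨j, hj, hmax⟩ := c.support.exists_max_image f (Finsupp.support_nonempty_iff.2 hne)
  have h := DFunLike.congr_fun hc (f j)
  rw [Finsupp.linearCombination_apply, Finsupp.sum, Finsupp.finsetSum_apply,
    Finset.sum_eq_single_of_mem j hj] at h
  · exact mul_ne_zero (Finsupp.mem_support_iff.1 hj) (hv j) h
  · intro k hk hkj
    rw [Finsupp.smul_apply, hvs k (f j) (lt_of_le_of_ne (hmax k hk) fun h => hkj (hf h)),
      smul_zero]

/-- Submodules of free modules over principal ideal domains are free. -/
theorem free_submodule_finsupp {E : Type*} (M : Submodule R (E →₀ R)) : Module.Free R M := by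
  obtain ⟨_, _⟩ := exists_wellFoundedLT E
  -- For a well-order on `E`, `I e` is the ideal of leading coefficients at `e`. Elements of `M`
  -- realising its generators, where nonzero, form a basis.
  let I : E → Ideal R := fun e =>
    (M ⊓ Finsupp.supported R R (Set.Iic e)).map (Finsupp.lapply e)
  let d : E → R := fun e => Submodule.IsPrincipal.generator (I e)
  have hd : ∀ e, ∃ v : E →₀ R, v ∈ M ∧ (∀ e', e < e' → v e' = 0) ∧ v e = d e := by
    intro e
    obtain ⟨v, ⟨hvM, hvs⟩, hv⟩ := Submodule.IsPrincipal.generator_mem (I e)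
    refine ⟨v, hvM, fun e' he' => ?_, hv⟩
    by_contra h
    exact not_lt_of_ge (hvs (Finsupp.mem_support_iff.2 h)) he'
  choose v hvM hvs hv using hd
  let w : {e // d e ≠ 0} → M := fun j => ⟨v j, hvM j⟩
  have hli : LinearIndependent R w := by
    refine LinearIndependent.of_comp M.subtype
      (linearIndependent_of_triangular (fun j : {e // d e ≠ 0} => (j : E))
        Subtype.val_injective _ (fun j => ?_) fun j => hvs j)
    exact (hv j).trans_ne j.2
  have hspan : ∀ e : E, ∀ x : M, (∀ e', e < e' → (x : E →₀ R) e' = 0) →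
      x ∈ Submodule.span R (Set.range w) := by
    intro e
    induction e using WellFoundedLT.induction with
    | ind e ih =>
    intro x hx
    have hlow : ∀ y : M, (∀ e', e ≤ e' → (y : E →₀ R) e' = 0) →
        y ∈ Submodule.span R (Set.range w) := by
      intro y hy
      by_cases hy0 : (y : E →₀ R) = 0
      · rw [Submodule.coe_eq_zero.1 hy0]
        exact zero_mem _
      have hs := Finsupp.support_nonempty_iff.2 hy0
      refine ih ((y : E →₀ R).support.max' hs) ?_ y fun e' he' => ?_
      · by_contra! h
        exact Finsupp.mem_support_iff.1 (Finset.max'_mem _ hs) (hy _ h)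
      · by_contra h
        exact not_lt_of_ge (Finset.le_max' _ _ (Finsupp.mem_support_iff.2 h)) he'
    have hxI : (x : E →₀ R) e ∈ I e := by
      refine ⟨x, ⟨x.2, fun e' he' => ?_⟩, rfl⟩
      by_contra h
      exact Finsupp.mem_support_iff.1 he' (hx e' (not_le.1 h))
    obtain ⟨r, hr⟩ := (Submodule.IsPrincipal.mem_iff_eq_smul_generator (I e)).1 hxI
    by_cases hde : d e = 0
    · refine hlow x fun e' he' => ?_
      rcases he'.eq_or_lt with rfl | h
      · rw [hr]
        exact (congrArg (r • ·) hde).trans (smul_zero r)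
      · exact hx e' h
    · have hy := hlow (x - r • w ⟨e, hde⟩) fun e' he' => by
        rcases he'.eq_or_lt with rfl | h
        · rw [Submodule.coe_sub, Submodule.coe_smul, Finsupp.sub_apply, Finsupp.smul_apply, hv,
            hr, sub_self]
        · rw [Submodule.coe_sub, Submodule.coe_smul, Finsupp.sub_apply, Finsupp.smul_apply,
            hvs e e' h, hx e' h, smul_zero, sub_zero]
      rw [← sub_add_cancel x (r • w ⟨e, hde⟩)]
      exact add_mem hy (Submodule.smul_mem _ _ (Submodule.subset_span ⟨_, rfl⟩))
  refine Module.Free.of_basis (Module.Basis.mk hli fun x _ => ?_)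
  by_cases hx0 : (x : E →₀ R) = 0
  · rw [Submodule.coe_eq_zero.1 hx0]
    exact zero_mem _
  have hs := Finsupp.support_nonempty_iff.2 hx0
  refine hspan ((x : E →₀ R).support.max' hs) x fun e' he' => ?_
  by_contra h
  exact not_lt_of_ge (Finset.le_max' _ _ (Finsupp.mem_support_iff.2 h)) he'

theorem free_submodule {A : Type*} [AddCommGroup A] [Module R A] [Module.Free R A]
    (M : Submodule R A) : Module.Free R M :=
  have := free_submodule_finsupp (M.map (Module.Free.chooseBasis R A).repr.toLinearMap)
  Module.Free.of_equiv ((Module.Free.chooseBasis R A).repr.submoduleMap M).symm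

end FreeSubmodule

/-! ### Large summands of a free abelian group of infinite rank. -/

section InfiniteRank

open Cardinal

variable {A : Type*} [AddCommGroup A] [Module.Free ℤ A]

theorem aleph0_le_rank_of_not_finite (hA : ¬ Module.Finite ℤ A) : ℵ₀ ≤ Module.rank ℤ A := by
  by_contra! h
  exact hA (Module.rank_lt_aleph0_iff.1 h)

/-- An idempotent whose range contains a copy of the whole module splits through it. -/
theorem exists_split_of_idempotent {e z : Module.End ℤ A} (he : e * e = e)
    (hz : Function.Injective z) (hez : e * z = z) :
    ∃ i p : Module.End ℤ A, p * i = 1 ∧ i * p = e := by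
  have hmem : ∀ a, z a ∈ LinearMap.range e := fun a => ⟨z a, LinearMap.congr_fun hez a⟩
  have hrank : Module.rank ℤ A = Module.rank ℤ (LinearMap.range e) := by
    refine le_antisymm ?_ (Submodule.rank_le _)
    exact LinearMap.rank_le_of_injective (z.codRestrict _ hmem)
      fun a b h => hz (congrArg Subtype.val h)
  have := free_submodule (LinearMap.range e)
  obtain ⟨f⟩ := nonempty_linearEquiv_of_rank_eq hrank
  refine ⟨(LinearMap.range e).subtype ∘ₗ f.toLinearMap, f.symm.toLinearMap ∘ₗ e.rangeRestrict,
    ?_, ?_⟩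
  · ext a
    have h : e.rangeRestrict (f a : A) = f a := by
      obtain ⟨b, hb⟩ := (f a).2
      refine Subtype.ext ?_
      change e (f a : A) = f a
      rw [← hb]
      exact LinearMap.congr_fun he b
    simp [h]
  · ext a
    simp

theorem exists_linearEquiv_prod_self (hA : ¬ Module.Finite ℤ A) :
    ∃ a₁ b₁ a₂ b₂ : Module.End ℤ A, b₁ * a₁ = 1 ∧ b₂ * a₂ = 1 ∧ b₁ * a₂ = 0 ∧ b₂ * a₁ = 0 ∧
      a₁ * b₁ + a₂ * b₂ = 1 := by
  have hrank : Module.rank ℤ A = Module.rank ℤ (A × A) := by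
    rw [rank_prod', add_eq_self (aleph0_le_rank_of_not_finite hA)]
  obtain ⟨f⟩ := nonempty_linearEquiv_of_rank_eq hrank
  refine ⟨f.symm.toLinearMap ∘ₗ LinearMap.inl ℤ A A, LinearMap.fst ℤ A A ∘ₗ f.toLinearMap,
    f.symm.toLinearMap ∘ₗ LinearMap.inr ℤ A A, LinearMap.snd ℤ A A ∘ₗ f.toLinearMap,
    ?_, ?_, ?_, ?_, ?_⟩
  · ext a; simp
  · ext a; simp
  · ext a; simp
  · ext a; simp
  · ext a; simp [← map_add]

/-- The diagonal action on `ℕ` copies of a module of infinite rank. -/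
theorem exists_diagonal_ringHom (hA : ¬ Module.Finite ℤ A) :
    ∃ (i₀ p₀ i p : Module.End ℤ A) (D : Module.End ℤ A →+* Module.End ℤ A),
      p₀ * i₀ = 1 ∧ p * i = 1 ∧ p₀ * i = 0 ∧ p * i₀ = 0 ∧ i₀ * p₀ + i * p = 1 ∧
      ∀ δ, D δ = i₀ * δ * p₀ + i * D δ * p := by
  have hrank : Module.rank ℤ A = Module.rank ℤ (ℕ →₀ A) := by
    rw [rank_finsupp, mk_nat, lift_aleph0, lift_uzero,
      aleph0_mul_eq (aleph0_le_rank_of_not_finite hA)]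
  obtain ⟨f⟩ := nonempty_linearEquiv_of_rank_eq hrank
  have hs : ∀ x : ℕ →₀ A, Finsupp.single 0 (x 0) +
      Finsupp.mapDomain Nat.succ (Finsupp.comapDomain Nat.succ x Nat.succ_injective.injOn) = x := by
    intro x
    ext n
    cases n with
    | zero => simp [Finsupp.mapDomain_of_notMem_range]
    | succ n =>
      rw [Finsupp.add_apply, ← Nat.succ_eq_add_one,
        Finsupp.mapDomain_apply Nat.succ_injective]
      simp
  refine ⟨f.symm.toLinearMap ∘ₗ Finsupp.lsingle 0, Finsupp.lapply 0 ∘ₗ f.toLinearMap,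
    f.symm.toLinearMap ∘ₗ Finsupp.lmapDomain A ℤ Nat.succ ∘ₗ f.toLinearMap,
    f.symm.toLinearMap ∘ₗ Finsupp.lcomapDomain Nat.succ Nat.succ_injective ∘ₗ f.toLinearMap,
    { toFun := fun δ => f.symm.toLinearMap ∘ₗ Finsupp.mapRange.linearMap δ ∘ₗ f.toLinearMap
      map_one' := ?_
      map_mul' := ?_
      map_zero' := ?_
      map_add' := ?_ }, ?_, ?_, ?_, ?_, ?_, ?_⟩
  · ext a
    simp [Module.End.one_eq_id]
  · intro g h
    ext a
    simp only [LinearMap.comp_apply, LinearEquiv.coe_coe, Module.End.mul_apply,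
      LinearEquiv.apply_symm_apply]
    congr 1
    ext n
    simp
  · ext a
    simp only [LinearMap.comp_apply, LinearEquiv.coe_coe, LinearMap.zero_apply]
    convert f.symm.map_zero
    ext n
    simp
  · intro g h
    ext a
    simp only [LinearMap.comp_apply, LinearEquiv.coe_coe, LinearMap.add_apply, ← map_add]
    congr 1
    ext n
    simp
  · ext a; simp
  · ext a
    simp only [Module.End.mul_apply, LinearMap.comp_apply, LinearEquiv.coe_coe,
      LinearEquiv.apply_symm_apply, Module.End.one_apply]
    rw [LinearEquiv.symm_apply_eq]
    ext n
    simp [Finsupp.lcomapDomain, Finsupp.mapDomain_apply Nat.succ_injective]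
  · ext a
    simp [Finsupp.mapDomain_of_notMem_range]
  · ext a
    simp only [Module.End.mul_apply, LinearMap.comp_apply, LinearEquiv.coe_coe,
      LinearEquiv.apply_symm_apply, LinearMap.zero_apply]
    rw [LinearEquiv.symm_apply_eq]
    ext n
    simp [Finsupp.lcomapDomain]
  · ext a
    simp only [Module.End.mul_apply, LinearMap.comp_apply, LinearEquiv.coe_coe,
      LinearEquiv.apply_symm_apply, LinearMap.add_apply, Module.End.one_apply, ← map_add]
    rw [LinearEquiv.symm_apply_eq]
    exact hs (f a)
  · intro δ
    ext a
    simp only [RingHom.coe_mk, MonoidHom.coe_mk, OneHom.coe_mk, Module.End.mul_apply,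
      LinearMap.comp_apply, LinearEquiv.coe_coe,
      LinearEquiv.apply_symm_apply, LinearMap.add_apply, Module.End.one_apply, ← map_add]
    congr 1
    rw [← hs (Finsupp.mapRange.linearMap δ (f a))]
    congr 1
    simp only [Finsupp.lmapDomain_apply]
    congr 1
    ext n
    simp [Finsupp.lcomapDomain, Finsupp.mapDomain_apply Nat.succ_injective]

omit [Module.Free ℤ A] in
theorem linearIndependent_of_pairwise_disjoint_support {E κ : Type*} (b : Module.Basis E ℤ A)
    (v : κ → A) (h0 : ∀ k, v k ≠ 0)
    (hd : Pairwise fun k l => Disjoint (b.repr (v k)).support (b.repr (v l)).support) :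
    LinearIndependent ℤ v := by
  rw [linearIndependent_iff']
  intro s c hc k hk
  have hne : b.repr (v k) ≠ 0 := fun h => h0 k (b.repr.map_eq_zero_iff.1 h)
  obtain ⟨e, he⟩ := Finsupp.support_nonempty_iff.2 hne
  have := DFunLike.congr_fun (congrArg b.repr hc) e
  rw [map_sum, Finsupp.finsetSum_apply, Finset.sum_eq_single_of_mem k hk] at this
  · simpa [Finsupp.mem_support_iff.1 he] using this
  · intro l _ hl
    have := Finset.disjoint_left.1 (hd hl.symm) he
    rw [map_smul, Finsupp.smul_apply, Finsupp.notMem_support_iff.1 this, smul_zero]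

universe u

/-- A family of nonzero vectors of the size of a basis, such that the supports of these vectors
and of their images are pairwise disjoint. -/
theorem exists_disjoint_supports {A : Type u} [AddCommGroup A] [Module.Free ℤ A]
    (hA : ¬ Module.Finite ℤ A) {E : Type u}
    (b : Module.Basis E ℤ A) (g : Module.End ℤ A) (S : A → Set E)
    (hS : ∀ a, S a = ((b.repr a).support ∪ (b.repr (g a)).support : Set E)) :
    ∃ v : E ⊕ E → A, (∀ k, v k ≠ 0) ∧ Pairwise fun k l => Disjoint (S (v k)) (S (v l)) := by
  have hne : ∀ a, a ≠ 0 → (S a).Nonempty := by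
    intro a ha
    have hne : b.repr a ≠ 0 := fun h => ha (b.repr.map_eq_zero_iff.1 h)
    obtain ⟨e, he⟩ := Finsupp.support_nonempty_iff.2 hne
    exact ⟨e, hS a ▸ Or.inl he⟩
  obtain ⟨V, hV⟩ := zorn_subset {V : Set A | (∀ v ∈ V, v ≠ 0) ∧ V.PairwiseDisjoint S} (by
    intro c hc hchain
    refine ⟨⋃₀ c, ⟨?_, ?_⟩, fun s hs => Set.subset_sUnion_of_mem hs⟩
    · rintro v ⟨s, hs, hv⟩
      exact (hc hs).1 v hv
    · rw [Set.pairwiseDisjoint_sUnion hchain.directedOn]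
      exact fun s hs => (hc hs).2)
  obtain ⟨hV0, hVd⟩ := hV.prop
  have hE : #E = Module.rank ℤ A := b.mk_eq_rank''
  have hκ := aleph0_le_rank_of_not_finite hA
  have hcard : Module.rank ℤ A ≤ #V := by
    by_contra! hlt
    obtain ⟨T, hT⟩ : ∃ T : Set E, T = ⋃ v ∈ V, S v := ⟨_, rfl⟩
    have hSfin : ∀ a, (S a).Finite := fun a => by
      rw [hS]
      exact (Finset.finite_toSet _).union (Finset.finite_toSet _)
    have hTlt : #T < Module.rank ℤ A := by
      rcases V.finite_or_infinite with hfin | hinf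
      · have : T.Finite := hT ▸ hfin.biUnion fun a _ => hSfin a
        exact this.lt_aleph0.trans_le hκ
      · have : Infinite V := hinf.to_subtype
        refine lt_of_le_of_lt ?_ hlt
        rw [hT]
        refine (mk_biUnion_le S V).trans ?_
        refine (mul_le_mul' le_rfl (ciSup_le' fun a : V => (hSfin a).lt_aleph0.le)).trans ?_
        rw [mul_aleph0_eq (aleph0_le_mk V)]
    -- A nonzero kernel element of `L` has, together with its image under `g`, support off `T`, so
    -- it would enlarge the maximal family `V`.
    let L : A →ₗ[ℤ] (T →₀ ℤ) × (T →₀ ℤ) :=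
      (Finsupp.lsubtypeDomain T ∘ₗ b.repr.toLinearMap).prod
        (Finsupp.lsubtypeDomain T ∘ₗ b.repr.toLinearMap ∘ₗ g)
    have hL : ¬ Function.Injective L := fun h => by
      have := LinearMap.rank_le_of_injective L h
      rw [rank_prod', rank_finsupp_self, lift_id'] at this
      exact not_lt_of_ge this (add_lt_of_lt hκ hTlt hTlt)
    rw [← LinearMap.ker_eq_bot, Submodule.eq_bot_iff] at hL
    push Not at hL
    obtain ⟨a, ha, ha0⟩ := hL
    have haT : Disjoint (S a) T := by
      rw [Set.disjoint_left]
      intro e he heT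
      have h1 := DFunLike.congr_fun (congrArg Prod.fst (LinearMap.mem_ker.1 ha)) ⟨e, heT⟩
      have h2 := DFunLike.congr_fun (congrArg Prod.snd (LinearMap.mem_ker.1 ha)) ⟨e, heT⟩
      rw [hS] at he
      rcases he with he | he
      · exact Finsupp.mem_support_iff.1 he h1
      · exact Finsupp.mem_support_iff.1 he h2
    have hsub : ∀ v ∈ V, S v ⊆ T := fun v hv => hT ▸ Set.subset_biUnion_of_mem hv
    have hmem : insert a V ∈ {V : Set A | (∀ v ∈ V, v ≠ 0) ∧ V.PairwiseDisjoint S} :=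
      ⟨Set.forall_mem_insert.2 ⟨ha0, hV0⟩,
        hVd.insert fun v hv _ => haT.mono_right (hsub v hv)⟩
    have haV : a ∈ V := hV.le_of_ge hmem (Set.subset_insert a V) (Set.mem_insert a V)
    obtain ⟨e, he⟩ := hne a ha0
    exact Set.disjoint_left.1 haT he (hsub a haV he)
  have : #(E ⊕ E) ≤ #V := by
    rw [← add_def, hE, add_eq_self hκ]
    exact hcard
  obtain ⟨f⟩ := this
  exact ⟨fun k => f k, fun k => hV0 _ (f k).2, fun k l hkl =>
    hVd (f k).2 (f l).2 fun h => hkl (f.injective (Subtype.ext h))⟩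

/-- The kernel of a map between free modules, one containing a copy of the whole, splits. -/
theorem exists_split_ker {B : Type*} [AddCommGroup B] [Module.Free ℤ B] (f : A →ₗ[ℤ] B)
    {z : Module.End ℤ A} (hz : Function.Injective z) (hfz : f ∘ₗ z = 0) :
    ∃ i p : Module.End ℤ A, p * i = 1 ∧ f ∘ₗ i = 0 := by
  have := free_submodule (LinearMap.range f)
  obtain ⟨s, hs⟩ := f.rangeRestrict.exists_rightInverse_of_surjective f.range_rangeRestrict
  have hfs : ∀ a, f (s (f.rangeRestrict a)) = f a := fun a =>
    congrArg Subtype.val (LinearMap.congr_fun hs (f.rangeRestrict a))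
  obtain ⟨i, p, hpi, hip⟩ := exists_split_of_idempotent (e := 1 - s ∘ₗ f.rangeRestrict) (z := z)
    (by
      ext a
      have : f.rangeRestrict (s (f.rangeRestrict a)) = f.rangeRestrict a :=
        LinearMap.congr_fun hs _
      simp [this]) hz
    (by
      ext a
      have : f.rangeRestrict (z a) = 0 := Subtype.ext (LinearMap.congr_fun hfz a)
      simp [this])
  refine ⟨i, p, hpi, ?_⟩
  ext a
  have : i a = (1 - s ∘ₗ f.rangeRestrict) (i a) := by
    rw [← hip]
    exact congrArg i (LinearMap.congr_fun hpi a).symm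
  rw [LinearMap.comp_apply, this]
  simp [hfs]

omit [Module.Free ℤ A] in
open Classical in
theorem exists_coordinate_projection {E : Type*} (b : Module.Basis E ℤ A) (T : Set E) :
    ∃ e : Module.End ℤ A, ∀ a k,
      (k ∈ T → b.repr (e a) k = b.repr a k) ∧ (k ∉ T → b.repr (e a) k = 0) :=
  ⟨b.repr.symm.toLinearMap ∘ₗ (Finsupp.supported ℤ ℤ T).subtype ∘ₗ
    Finsupp.restrictDom ℤ ℤ T ∘ₗ b.repr.toLinearMap, fun a k => by
      constructor <;> intro hk <;> simp [Finsupp.filter_apply, hk]⟩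

/-- There are complementary large summands, one of which contains a large summand together with
its image under a given endomorphism. -/
theorem exists_large_summands (hA : ¬ Module.Finite ℤ A) (g : Module.End ℤ A) :
    ∃ i p j q : Module.End ℤ A, p * i = 1 ∧ q * j = 1 ∧ q * i = 0 ∧ q * g * i = 0 := by
  let b := Module.Free.chooseBasis ℤ A
  let S : A → Set (Module.Free.ChooseBasisIndex ℤ A) := fun a =>
    ((b.repr a).support ∪ (b.repr (g a)).support : Set _)
  obtain ⟨v, hv0, hv⟩ := exists_disjoint_supports hA b g S fun a => rfl
  have hli : LinearIndependent ℤ v :=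
    linearIndependent_of_pairwise_disjoint_support b v hv0 fun k l hkl => by
      refine Finset.disjoint_coe.1 ?_
      exact (hv hkl).mono (fun _ => Or.inl) (fun _ => Or.inl)
  have hli_inl := hli.comp _ Sum.inl_injective
  have hli_inr := hli.comp _ Sum.inr_injective
  -- `e` kills the left half of the family and its image under `g`. It fixes the right half, so its
  -- range is large and gives `j`, `q`; the left half then makes the kernel of `(q, q * g)` large,
  -- giving `i`, `p`.
  obtain ⟨e, he⟩ := exists_coordinate_projection b (⋃ k, S (v (Sum.inl k)))ᶜ
  simp only [Set.mem_compl_iff, not_not] at he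
  obtain ⟨j, q, hqj, hjq⟩ := exists_split_of_idempotent (e := e) (z := b.constr ℤ (v ∘ Sum.inr))
    (by
      ext a
      refine b.ext_elem fun k => ?_
      rw [Module.End.mul_apply]
      by_cases hk : k ∈ ⋃ k, S (v (Sum.inl k))
      · rw [(he _ k).2 hk, (he _ k).2 hk]
      · rw [(he _ k).1 hk])
    (b.injective_constr_of_linearIndependent hli_inr)
    (by
      refine b.ext fun k => b.ext_elem fun l => ?_
      rw [Module.End.mul_apply, b.constr_basis]
      by_cases hl : l ∈ ⋃ k, S (v (Sum.inl k))
      swap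
      · exact (he _ l).1 hl
      rw [(he _ l).2 hl]
      obtain ⟨k', hk'⟩ := Set.mem_iUnion.1 hl
      by_contra h
      exact Set.disjoint_left.1 (hv Sum.inl_ne_inr) hk'
        (Or.inl (Finsupp.mem_support_iff.2 (Ne.symm h))))
  have hq : ∀ a, e a = 0 → q a = 0 := fun a ha => by
    have : q (j (q a)) = q a := LinearMap.congr_fun hqj (q a)
    rw [← this, show j (q a) = e a from LinearMap.congr_fun hjq a, ha, map_zero]
  have hev : ∀ k, e (v (Sum.inl k)) = 0 ∧ e (g (v (Sum.inl k))) = 0 := by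
    intro k
    constructor <;>
    · refine b.ext_elem fun l => ?_
      rw [map_zero, Finsupp.zero_apply]
      by_cases hl : l ∈ ⋃ k, S (v (Sum.inl k))
      · exact (he _ l).2 hl
      rw [(he _ l).1 hl]
      by_contra h
      refine hl (Set.mem_iUnion.2 ⟨k, ?_⟩)
      first
      | exact Or.inl (Finsupp.mem_support_iff.2 h)
      | exact Or.inr (Finsupp.mem_support_iff.2 h)
  obtain ⟨i, p, hpi, hi⟩ := exists_split_ker (q.prod (q * g)) (z := b.constr ℤ (v ∘ Sum.inl))
    (b.injective_constr_of_linearIndependent hli_inl)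
    (by
      refine b.ext fun k => ?_
      rw [LinearMap.comp_apply, b.constr_basis]
      exact Prod.ext (hq _ (hev k).1) (hq _ (hev k).2))
  refine ⟨i, p, j, q, hpi, hqj, ?_, ?_⟩
  · ext a
    exact congrArg Prod.fst (LinearMap.congr_fun hi a)
  · ext a
    exact congrArg Prod.snd (LinearMap.congr_fun hi a)

end InfiniteRank

/-! ### Change of decomposition and the Eilenberg swindle. -/

section Swindle

variable {R : Type*} [Ring R] {N : Subgroup Rˣ} [N.Normal]

namespace Subgroup

/-- Transvections with respect to one decomposition into three summands are conjugate to those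
with respect to any other. -/
theorem transvection_mem_values_of_conj {m : ℕ} {i₁ i₂ i₃ p₁ p₂ p₃ j₁ j₂ j₃ q₁ q₂ q₃ : R}
    (h₁₁ : p₁ * i₁ = 1) (h₁₂ : p₁ * i₂ = 0) (h₁₃ : p₁ * i₃ = 0)
    (h₂₁ : p₂ * i₁ = 0) (h₂₂ : p₂ * i₂ = 1) (h₂₃ : p₂ * i₃ = 0)
    (h₃₁ : p₃ * i₁ = 0) (h₃₂ : p₃ * i₂ = 0) (h₃₃ : p₃ * i₃ = 1)
    (hip : i₁ * p₁ + i₂ * p₂ + i₃ * p₃ = 1)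
    (k₁₁ : q₁ * j₁ = 1) (k₁₂ : q₁ * j₂ = 0) (k₁₃ : q₁ * j₃ = 0)
    (k₂₁ : q₂ * j₁ = 0) (k₂₂ : q₂ * j₂ = 1) (k₂₃ : q₂ * j₃ = 0)
    (k₃₁ : q₃ * j₁ = 0) (k₃₂ : q₃ * j₂ = 0) (k₃₃ : q₃ * j₃ = 1)
    (hjq : j₁ * q₁ + j₂ * q₂ + j₃ * q₃ = 1) {h : R}
    (hN : 1 + m • (i₁ * h * p₂) ∈ N.values) : 1 + m • (j₁ * h * q₂) ∈ N.values := by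
  have e1 : (j₁ * p₁ + j₂ * p₂ + j₃ * p₃) * (i₁ * q₁ + i₂ * q₂ + i₃ * q₃) = 1 := by
    simp only [mul_add, add_mul, mul_assoc, mul_mul_of_mul_eq h₁₁, mul_mul_of_mul_eq h₁₂,
      mul_mul_of_mul_eq h₁₃, mul_mul_of_mul_eq h₂₁, mul_mul_of_mul_eq h₂₂, mul_mul_of_mul_eq h₂₃,
      mul_mul_of_mul_eq h₃₁, mul_mul_of_mul_eq h₃₂, mul_mul_of_mul_eq h₃₃, zero_mul, mul_zero,
      one_mul, add_zero, zero_add, hjq]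
  have e2 : (i₁ * q₁ + i₂ * q₂ + i₃ * q₃) * (j₁ * p₁ + j₂ * p₂ + j₃ * p₃) = 1 := by
    simp only [mul_add, add_mul, mul_assoc, mul_mul_of_mul_eq k₁₁, mul_mul_of_mul_eq k₁₂,
      mul_mul_of_mul_eq k₁₃, mul_mul_of_mul_eq k₂₁, mul_mul_of_mul_eq k₂₂, mul_mul_of_mul_eq k₂₃,
      mul_mul_of_mul_eq k₃₁, mul_mul_of_mul_eq k₃₂, mul_mul_of_mul_eq k₃₃, zero_mul, mul_zero,
      one_mul, add_zero, zero_add, hip]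
  have := conj_mem_values e1 e2 hN
  convert this using 1
  rw [mul_add _ 1 (m • _), mul_one, add_mul, e1]
  simp only [mul_smul_comm, smul_mul_assoc, mul_add, add_mul, mul_assoc, mul_mul_of_mul_eq h₁₁,
    mul_mul_of_mul_eq h₁₂, mul_mul_of_mul_eq h₁₃, mul_mul_of_mul_eq h₂₁, mul_mul_of_mul_eq h₂₂,
    mul_mul_of_mul_eq h₂₃, mul_mul_of_mul_eq h₃₁, h₂₂, h₂₁, h₂₃, zero_mul, mul_zero,
    smul_zero, one_mul, add_zero, zero_add]

/-- Eilenberg swindle: `hD` says that `D d` is `d` followed by a copy of `D d`. On the summands `i`,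
`X`, `X'`, with `u = 1 + m • d` and `U = 1 + m • D d`, Whitehead's lemma gives `diag(u, U, U⁻¹)` and
`diag(1, U⁻¹, U)`, whose product is `diag(u, 1, 1)`. -/
theorem diagonal_mem_values {m : ℕ} (hN : N.HasTransvections m)
    {i₀ p₀ j q : R} {D : R →+* R} (h₀ : p₀ * i₀ = 1) (hq : q * j = 1)
    (h₀q : p₀ * j = 0) (hq₀ : q * i₀ = 0) (h₁ : i₀ * p₀ + j * q = 1)
    (hD : ∀ δ, D δ = i₀ * δ * p₀ + j * D δ * q)
    {i p X Y X' Y' : R} (hpi : p * i = 1) (hYX : Y * X = 1) (hYX' : Y' * X' = 1)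
    (hpX : p * X = 0) (hYi : Y * i = 0) (hpX' : p * X' = 0) (hYi' : Y' * i = 0)
    (hY'X : Y' * X = 0) (hY'X' : Y * X' = 0)
    {d d' : R} (hd : (1 + m • d) * (1 + m • d') = 1) (hd' : (1 + m • d') * (1 + m • d) = 1) :
    1 + m • (i * d * p) ∈ N.values := by
  have hDd : (1 + m • D d) * (1 + m • D d') = 1 := by
    rw [← map_nsmul, ← map_nsmul, ← map_one D, ← map_add, ← map_add, ← map_mul, hd]
  have hDd' : (1 + m • D d') * (1 + m • D d) = 1 := by
    rw [← map_nsmul, ← map_nsmul, ← map_one D, ← map_add, ← map_add, ← map_mul, hd']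
  -- The sum of the summands `i` and `X` is treated as one copy of the module, through the splitting
  -- `i₀`, `j`.
  have w1 := whitehead_mem_values hN (i := i * p₀ + X * q) (p := i₀ * p + j * Y) (i' := X')
    (p' := Y') (a := D d) (b := D d')
    (by simp only [mul_add, add_mul, mul_assoc, mul_mul_of_mul_eq hpi, mul_mul_of_mul_eq hYX,
          mul_mul_of_mul_eq hpX, mul_mul_of_mul_eq hYi, zero_mul, mul_zero, one_mul, add_zero,
          zero_add, h₁])
    hYX'
    (by simp only [mul_add, add_mul, mul_assoc, hpX', hY'X', mul_zero, add_zero])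
    (by simp only [mul_add, add_mul, mul_mul_of_mul_eq hYi', mul_mul_of_mul_eq hY'X, zero_mul,
          add_zero])
    hDd hDd'
  have w2 := whitehead_mem_values hN hYX hYX' hY'X' hY'X hDd' hDd
  have e : (i * p₀ + X * q) * D d * (i₀ * p + j * Y) = i * d * p + X * D d * Y := by
    conv_lhs => rw [hD d]
    simp only [mul_add, add_mul, mul_assoc, mul_mul_of_mul_eq h₀, mul_mul_of_mul_eq hq,
      mul_mul_of_mul_eq h₀q, mul_mul_of_mul_eq hq₀, h₀, hq, h₀q, hq₀, zero_mul, mul_zero, one_mul,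
      add_zero, zero_add]
  rw [e] at w1
  convert mul_mem w1 w2 using 1
  have hsm : ∀ a t b : R, m • (a * t * b) = a * (m • t) * b := fun a t b => by
    rw [mul_smul_comm, smul_mul_assoc]
  simp only [smul_add, hsm]
  have huv := mul_eq_neg_sub_of_one_add_mul_one_add hDd
  have hvu := mul_eq_neg_sub_of_one_add_mul_one_add hDd'
  generalize m • D d = u at *
  generalize m • D d' = v at *
  simp only [mul_add, add_mul, mul_one, one_mul, mul_assoc, mul_mul_of_mul_eq hYX,
    mul_mul_of_mul_eq hYX', mul_mul_of_mul_eq hpX, mul_mul_of_mul_eq hpX', mul_mul_of_mul_eq hY'X,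
    mul_mul_of_mul_eq hY'X', mul_mul_of_mul_eq huv, mul_mul_of_mul_eq hvu, zero_mul, mul_zero,
    sub_mul, neg_mul, mul_sub, mul_neg, add_zero, zero_add]
  abel_nf

end Subgroup

end Swindle

/-! ### From particular transvections to all transvections and invertible blocks. -/

section InfiniteRank

variable {A : Type*} [AddCommGroup A] [Module.Free ℤ A]

/-- Correcting `i₂` by its component along `i₁` makes the first two summands independent. The
complementary idempotent has large range, as it fixes the injective `z`, and supplies the third. -/
theorem exists_complete_system {i₁ p₁ i₂ p₂ w z : Module.End ℤ A} (h₁ : p₁ * i₁ = 1)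
    (h₂ : p₂ * i₂ = 1) (h₂₁ : p₂ * i₁ = 0) (hw : w * z = 1) (h₁z : p₁ * z = 0)
    (h₂z : p₂ * z = 0) :
    ∃ i₂' i₃ p₃ : Module.End ℤ A, p₂ * i₂' = 1 ∧ p₁ * i₂' = 0 ∧ p₃ * i₃ = 1 ∧ p₁ * i₃ = 0 ∧
      p₂ * i₃ = 0 ∧ p₃ * i₁ = 0 ∧ p₃ * i₂' = 0 ∧ i₁ * p₁ + i₂' * p₂ + i₃ * p₃ = 1 := by
  obtain ⟨k, hk⟩ : ∃ k, k = i₂ - i₁ * p₁ * i₂ := ⟨_, rfl⟩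
  have h₂k : p₂ * k = 1 := by
    simp only [hk, mul_sub, mul_assoc, mul_mul_of_mul_eq h₂₁, h₂, zero_mul, sub_zero]
  have h₁k : p₁ * k = 0 := by
    simp only [hk, mul_sub, mul_assoc, mul_mul_of_mul_eq h₁, one_mul, sub_self]
  have hz : Function.Injective z := fun a b h => by
    have := congrArg w h
    rwa [← Module.End.mul_apply, ← Module.End.mul_apply, hw] at this
  obtain ⟨e, he⟩ : ∃ e, e = 1 - i₁ * p₁ - k * p₂ := ⟨_, rfl⟩
  have hp₁e : p₁ * e = 0 := by
    simp only [he, mul_sub, mul_one, mul_mul_of_mul_eq h₁, mul_mul_of_mul_eq h₁k, zero_mul,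
      one_mul, sub_self]
  have hp₂e : p₂ * e = 0 := by
    simp only [he, mul_sub, mul_one, mul_mul_of_mul_eq h₂₁, mul_mul_of_mul_eq h₂k, zero_mul,
      one_mul, sub_self, sub_zero]
  have hei : e * i₁ = 0 := by
    simp only [he, sub_mul, one_mul, mul_assoc, h₁, h₂₁, mul_zero, mul_one, sub_self]
  have hek : e * k = 0 := by
    simp only [he, sub_mul, one_mul, mul_assoc, h₁k, h₂k, mul_zero, mul_one, sub_self, sub_zero]
  have hee : e * e = e := by
    conv_lhs => enter [1]; rw [he]
    simp only [sub_mul, one_mul, mul_assoc, hp₁e, hp₂e, mul_zero, sub_zero]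
  obtain ⟨j, q, hqj, hjq⟩ := exists_split_of_idempotent hee hz (by
    simp only [he, sub_mul, one_mul, mul_assoc, h₁z, h₂z, mul_zero, sub_zero])
  have hj : j = e * j := by rw [← hjq, mul_assoc, hqj, mul_one]
  have hq : q = q * e := by rw [← hjq, ← mul_assoc, hqj, one_mul]
  refine ⟨k, j, q, h₂k, h₁k, hqj, ?_, ?_, ?_, ?_, ?_⟩
  · rw [hj, ← mul_assoc, hp₁e, zero_mul]
  · rw [hj, ← mul_assoc, hp₂e, zero_mul]
  · rw [hq, mul_assoc, hei, mul_zero]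
  · rw [hq, mul_assoc, hek, mul_zero]
  · rw [hjq, he]; abel

variable (hA : ¬ Module.Finite ℤ A) {N : Subgroup (Module.End ℤ A)ˣ} [N.Normal] {m : ℕ}
include hA

/-- Any two decompositions into three large summands are conjugate, so one such family of
transvections gives all those leaving room for a third summand. A general one is a product of two of
these. -/
theorem hasTransvections_of_room {i₁ p₁ i₂ p₂ w z : Module.End ℤ A} (h₁ : p₁ * i₁ = 1)
    (h₂ : p₂ * i₂ = 1) (h₂₁ : p₂ * i₁ = 0) (hw : w * z = 1) (h₁z : p₁ * z = 0)
    (h₂z : p₂ * z = 0) (hN : ∀ h, 1 + m • (i₁ * h * p₂) ∈ N.values) :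
    N.HasTransvections m := by
  obtain ⟨i₂', i₃, p₃, h₂₂, h₁₂, h₃₃, h₁₃, h₂₃, h₃₁, h₃₂, hip⟩ :=
    exists_complete_system h₁ h₂ h₂₁ hw h₁z h₂z
  obtain ⟨a₁, b₁, a₂, b₂, ha₁, ha₂, ha₁₂, ha₂₁, hab⟩ := exists_linearEquiv_prod_self hA
  intro i p p' i' h hpi hp'i hpi'
  -- Replacing `p` by its half `b * p` frees the other half, embedded by `a'`, to serve as the third
  -- summand.
  have key : ∀ a b a' b' h : Module.End ℤ A, b * a = 1 → b * a' = 0 → b' * a' = 1 →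
      1 + m • (i * h * (b * p)) ∈ N.values := by
    intro a b a' b' h hba hba' hba''
    obtain ⟨j₂', j₃, q₃, k₂₂, k₁₂, k₃₃, k₁₃, k₂₃, k₃₁, k₃₂, hjq⟩ :=
      exists_complete_system (i₁ := i) (p₁ := p') (i₂ := i' * a) (p₂ := b * p) (w := b' * p)
        (z := (i' - i * p' * i') * a') hp'i
        (by rw [mul_assoc, mul_mul_of_mul_eq hpi', one_mul, hba])
        (by rw [mul_assoc, hpi, mul_zero])
        (by simp only [mul_assoc, sub_mul, mul_sub, mul_mul_of_mul_eq hpi',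
              mul_mul_of_mul_eq hpi, zero_mul, mul_zero, one_mul, sub_zero, hba''])
        (by simp only [mul_assoc, sub_mul, mul_sub, mul_mul_of_mul_eq hp'i, one_mul, sub_self])
        (by simp only [mul_assoc, sub_mul, mul_sub, mul_mul_of_mul_eq hpi',
              mul_mul_of_mul_eq hpi, zero_mul, mul_zero, one_mul, sub_zero, hba'])
    exact Subgroup.transvection_mem_values_of_conj h₁ h₁₂ h₁₃ h₂₁ h₂₂ h₂₃ h₃₁ h₃₂ h₃₃ hip
      hp'i k₁₂ k₁₃ (by rw [mul_assoc, hpi, mul_zero]) k₂₂ k₂₃ k₃₁ k₃₂ k₃₃ hjq (hN h)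
  have := mul_mem (key a₁ b₁ a₂ b₂ (h * a₁) ha₁ ha₁₂ ha₂) (key a₂ b₂ a₁ b₁ (h * a₂) ha₂ ha₂₁ ha₁)
  convert this using 1
  have hp : p = a₁ * (b₁ * p) + a₂ * (b₂ * p) := by
    rw [← mul_assoc, ← mul_assoc, ← add_mul, hab, one_mul]
  simp only [mul_add, add_mul, mul_one, one_mul, mul_assoc, mul_smul_comm, smul_mul_assoc,
    mul_mul_of_mul_eq hpi, zero_mul, mul_zero, smul_zero, add_zero]
  conv_lhs => rw [hp]
  simp only [mul_add, smul_add]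
  abel

/-- The other summand `i₁` is halved to make the two auxiliary copies used by the swindle. -/
theorem one_add_mem_values_of_summand (hN : N.HasTransvections m)
    {i₁ p₁ i₂ p₂ d d' : Module.End ℤ A} (h₁ : p₁ * i₁ = 1) (h₂ : p₂ * i₂ = 1)
    (h₁₂ : p₁ * i₂ = 0) (h₂₁ : p₂ * i₁ = 0)
    (hd : (1 + m • d) * (1 + m • d') = 1) (hd' : (1 + m • d') * (1 + m • d) = 1) :
    1 + m • (i₂ * d * p₂) ∈ N.values := by
  obtain ⟨a₁, b₁, a₂, b₂, ha₁, ha₂, ha₁₂, ha₂₁, -⟩ := exists_linearEquiv_prod_self hA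
  obtain ⟨i₀, p₀, j, q, D, h₀, hq, h₀q, hq₀, h, hD⟩ := exists_diagonal_ringHom hA
  refine Subgroup.diagonal_mem_values hN h₀ hq h₀q hq₀ h hD (X := i₁ * a₁) (Y := b₁ * p₁)
    (X' := i₁ * a₂) (Y' := b₂ * p₁) h₂ ?_ ?_ ?_ ?_ ?_ ?_ ?_ ?_ hd hd' <;>
  simp only [mul_assoc, mul_mul_of_mul_eq h₁, mul_mul_of_mul_eq h₂₁, h₁₂, one_mul, zero_mul,
    mul_zero, ha₁, ha₂, ha₁₂, ha₂₁]

end InfiniteRank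

/-! ### From transvections to the principal congruence subgroup. -/

section InfiniteRank

open Cardinal

variable {A : Type*} [AddCommGroup A] [Module.Free ℤ A]

/-- A normal subgroup containing all transvections of level `m` contains the principal congruence
subgroup of level `m`. -/
theorem mem_values_of_eq_one_add (hA : ¬ Module.Finite ℤ A)
    {N : Subgroup (Module.End ℤ A)ˣ} [N.Normal] {m : ℕ} (hN : N.HasTransvections m)
    {f f' g : Module.End ℤ A} (hff : f * f' = 1) (hff' : f' * f = 1) (hg : f = 1 + m • g) :
    f ∈ N.values := by
  obtain ⟨i, p₀, j, q, hp₀i, hqj, hqi, hqgi⟩ := exists_large_summands hA g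
  rw [mul_assoc] at hqgi
  obtain ⟨p, hp⟩ : ∃ p, p = p₀ * (1 - j * q) := ⟨_, rfl⟩
  have hpi : p * i = 1 := by
    simp only [hp, mul_assoc, sub_mul, mul_sub, mul_one, one_mul, hqi, mul_zero, sub_zero, hp₀i]
  have hpj : p * j = 0 := by
    simp only [hp, mul_assoc, sub_mul, mul_sub, mul_one, one_mul, hqj, sub_self]
  have hfi : f * i = i + m • (g * i) := by rw [hg, add_mul, one_mul, smul_mul_assoc]
  have hqfi : q * (f * i) = 0 := by rw [hfi, mul_add, hqi, mul_smul_comm, hqgi, smul_zero, add_zero]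
  obtain ⟨l, hl⟩ : ∃ l, l = p * f' * (1 - j * q) := ⟨_, rfl⟩
  have hlj : l * j = 0 := by
    simp only [hl, mul_assoc, sub_mul, mul_sub, mul_one, one_mul, hqj, sub_self]
  have hlfi : l * (f * i) = 1 := by
    simp only [hl, mul_assoc, sub_mul, mul_sub, mul_one, one_mul, hqfi, mul_zero, sub_zero,
      mul_mul_of_mul_eq hff', hpi]
  -- `t₁` sends `i` to `i + m • j`; conjugation by `1 + g * i * q` turns this into `f * i + m • j`,
  -- and `t₃` removes `m • j`. The product `u` therefore agrees with `f` on `i`.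
  obtain ⟨t₁, ht₁⟩ : ∃ t, t = 1 + m • (j * 1 * p) := ⟨_, rfl⟩
  obtain ⟨t₃, ht₃⟩ : ∃ t, t = 1 + m • (j * (-1) * l) := ⟨_, rfl⟩
  have ht₁mem : t₁ ∈ N.values := ht₁ ▸ hN j p q i 1 hpj hqj hpi
  have ht₃mem : t₃ ∈ N.values := ht₃ ▸ hN j l q (f * i) (-1) hlj hqj hlfi
  have e1 : (1 + g * i * q) * (1 - g * i * q) = 1 := one_add_mul_one_sub_of_mul_eq_zero hqgi
  have e2 : (1 - g * i * q) * (1 + g * i * q) = 1 := one_sub_mul_one_add_of_mul_eq_zero hqgi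
  obtain ⟨u, hu, huτ⟩ := mul_mem ht₃mem (Subgroup.conj_mem_values e1 e2 ht₁mem)
  rw [Units.coeHom_apply] at huτ
  have hui : u * i = f * i := by
    have : (1 + g * i * q) * t₁ * (1 - g * i * q) * i = f * i + m • j := by
      simp only [ht₁, mul_one, mul_assoc, sub_mul, one_mul, hqi, mul_zero, sub_zero, add_mul,
        smul_mul_assoc, hpi, mul_add, mul_smul_comm, hqj, hfi, smul_add, add_zero]
      abel
    rw [huτ, mul_assoc, this, ht₃]
    simp only [add_mul, mul_add, one_mul, smul_mul_assoc, mul_assoc, mul_smul_comm, neg_mul,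
      mul_neg, hlj, hlfi, smul_zero, mul_zero, mul_one, neg_zero, add_zero, smul_neg]
    abel
  obtain ⟨s, hs⟩ : ∃ s, (u : Module.End ℤ A) = 1 + m • s := by
    refine ⟨(1 + g * i * q) * (j * p) * (1 - g * i * q) + j * (-1) * l *
      ((1 + g * i * q) * t₁ * (1 - g * i * q)), ?_⟩
    have : (1 + g * i * q) * t₁ * (1 - g * i * q) =
        1 + m • ((1 + g * i * q) * (j * p) * (1 - g * i * q)) := by
      rw [ht₁, mul_add _ 1, mul_one, add_mul _ (_ * _ : Module.End ℤ A), e1, mul_one,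
        mul_smul_comm, smul_mul_assoc]
    rw [huτ, ht₃, add_mul 1, one_mul, smul_mul_assoc, smul_add, ← add_assoc, ← this]
  have hu1 : ((u⁻¹ : (Module.End ℤ A)ˣ) : Module.End ℤ A) * u = 1 := u.inv_mul
  have hu2 : (u : Module.End ℤ A) * (u⁻¹ : (Module.End ℤ A)ˣ) = 1 := u.mul_inv
  generalize ((u⁻¹ : (Module.End ℤ A)ˣ) : Module.End ℤ A) = u' at hu1 hu2
  obtain ⟨γ, hγ⟩ : ∃ γ, γ = u' * f := ⟨_, rfl⟩
  obtain ⟨γ', hγ'⟩ : ∃ γ', γ' = f' * u := ⟨_, rfl⟩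
  have hγγ : γ * γ' = 1 := by
    rw [hγ, hγ', mul_assoc, mul_mul_of_mul_eq hff, one_mul, hu1]
  have hγγ' : γ' * γ = 1 := by
    rw [hγ, hγ', mul_assoc, mul_mul_of_mul_eq hu2, one_mul, hff']
  have hγi : γ * i = i := by rw [hγ, mul_assoc, ← hui, mul_mul_of_mul_eq hu1, one_mul]
  have hγ'i : γ' * i = i := by rw [hγ', mul_assoc, hui, mul_mul_of_mul_eq hff', one_mul]
  obtain ⟨g₁, hg₁⟩ : ∃ g₁, γ = 1 + m • g₁ := by
    refine ⟨u' * (g - s), ?_⟩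
    rw [hγ, mul_sub, smul_sub, ← mul_smul_comm, ← mul_smul_comm, ← hu1, hs, hg]
    noncomm_ring
  obtain ⟨g₂, hg₂⟩ : ∃ g₂, γ' = 1 + m • g₂ := by
    refine ⟨-(γ' * g₁), ?_⟩
    rw [hg₁, mul_add, mul_one, mul_smul_comm] at hγγ'
    rw [smul_neg, ← hγγ', add_neg_cancel_right]
  have hjinj : Function.Injective j := fun a b h => by
    have := congrArg q h
    rwa [← Module.End.mul_apply, ← Module.End.mul_apply, hqj] at this
  obtain ⟨i₂, p₂, hpi₂, hip₂⟩ := exists_split_of_idempotent (e := 1 - i * p) (z := j)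
    (by simp only [mul_assoc, sub_mul, mul_sub, mul_one, one_mul, mul_mul_of_mul_eq hpi, sub_self,
          sub_zero])
    hjinj (by rw [sub_mul, one_mul, mul_assoc, hpj, mul_zero, sub_zero])
  have hp₂i : p₂ * i = 0 := by
    rw [← one_mul (p₂ * i), ← hpi₂, mul_assoc, ← mul_assoc i₂, hip₂, sub_mul, mul_assoc, hpi,
      one_mul, mul_one, sub_self, mul_zero]
  have hpi₂' : p * i₂ = 0 := by
    rw [← mul_one (p * i₂), ← hpi₂, mul_assoc, ← mul_assoc i₂, hip₂, sub_mul, one_mul, mul_sub,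
      mul_assoc i, mul_mul_of_mul_eq hpi, one_mul, sub_self]
  have hsum : i₂ * p₂ = 1 - i * p := hip₂
  -- An automorphism fixing `i` is block triangular for `i`, `i₂`, so compression to `i₂` preserves
  -- inverses.
  have hδ : ∀ a b c d : Module.End ℤ A, a = 1 + m • c → b = 1 + m • d → a * b = 1 → a * i = i →
      (1 + m • (p₂ * c * i₂)) * (1 + m • (p₂ * d * i₂)) = 1 := by
    intro a b c d ha hb hab hai
    have e : ∀ a c : Module.End ℤ A, a = 1 + m • c → 1 + m • (p₂ * c * i₂) = p₂ * a * i₂ := by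
      intro a c ha
      rw [ha, mul_add, add_mul, mul_one, hpi₂, mul_smul_comm, smul_mul_assoc]
    rw [e a c ha, e b d hb]
    simp only [mul_assoc, mul_mul_of_mul_eq hsum, sub_mul, mul_sub, one_mul,
      mul_mul_of_mul_eq hai, mul_mul_of_mul_eq hp₂i, zero_mul, sub_zero, mul_mul_of_mul_eq hab,
      hpi₂]
  have h1 := one_add_mem_values_of_summand hA hN hpi hpi₂ hpi₂' hp₂i
    (hδ _ _ _ _ hg₁ hg₂ hγγ hγi) (hδ _ _ _ _ hg₂ hg₁ hγγ' hγ'i)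
  have h2 := hN i p₂ p i₂ (p * g₁ * i₂) hp₂i hpi hpi₂
  have hγmem : γ ∈ N.values := by
    convert mul_mem h1 h2 using 1
    have hm : (m • g₁) * i = 0 := by
      rw [hg₁, add_mul, one_mul] at hγi
      exact add_eq_left.1 hγi
    simp only [smul_mul_assoc] at hm
    have e : i₂ * (p₂ * g₁ * i₂) * p₂ + i * (p * g₁ * i₂) * p₂ = g₁ - g₁ * i * p := by
      calc _ = (i₂ * p₂ + i * p) * g₁ * (i₂ * p₂) := by noncomm_ring
        _ = _ := by rw [hsum, sub_add_cancel, one_mul, mul_sub, mul_one, mul_assoc]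
    have e' : m • (i₂ * (p₂ * g₁ * i₂) * p₂) + m • (i * (p * g₁ * i₂) * p₂) = m • g₁ := by
      rw [← smul_add, e, smul_sub, ← smul_mul_assoc, hm, zero_mul, sub_zero]
    rw [hg₁, ← e']
    simp only [mul_add, add_mul, mul_one, one_mul, mul_assoc, mul_smul_comm, smul_mul_assoc,
      mul_mul_of_mul_eq hp₂i, zero_mul, mul_zero, smul_zero, add_zero]
    abel
  have : f = u * γ := by rw [hγ, ← mul_assoc, hu2, one_mul]
  rw [this]
  exact mul_mem (Subgroup.coe_mem_values.2 hu) hγmem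

end InfiniteRank

/-! ### Transvections from the given automorphism. -/

section InfiniteRank

open Cardinal

theorem exists_retraction {E A : Type*} [AddCommGroup A] (b : Module.Basis E ℤ A) (w : E → E)
    (hw : Function.Injective w) : ∃ r : Module.End ℤ A, (∀ t, r (b (w t)) = b t) ∧
      ∀ s, s ∉ Set.range w → r (b s) = 0 := by
  classical
  refine ⟨b.constr ℤ (Function.extend w b 0), fun t => ?_, fun s hs => ?_⟩
  · rw [b.constr_basis, hw.extend_apply]
  · rw [b.constr_basis, Function.extend_apply' _ _ _ hs, Pi.zero_apply]

universe u v

theorem exists_embedding_fin_prod {T : Type u} {ι : Type v} [Infinite T]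
    (h : lift.{v} #T = lift.{u} #ι + lift.{u} #ι) : Nonempty (Fin 4 × T ↪ ι) := by
  have hT : ℵ₀ ≤ lift.{v} #T := by simp
  have hι : ℵ₀ ≤ lift.{u} #ι := by
    by_contra! hlt
    exact not_lt_of_ge hT (h ▸ add_lt_aleph0 hlt hlt)
  rw [add_eq_self hι] at h
  rw [← lift_mk_le', ← h, mk_prod, lift_mul]
  simp only [lift_lift, mk_fin, lift_natCast, lift_id, lift_uzero]
  exact mul_le_of_le hT ((natCast_lt_aleph0 (n := 4)).le.trans hT) le_rfl

/-- The transvections of level `m` lie in any normal subgroup that contains an automorphism acting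
on a large unimodular set as in the hypotheses. -/
theorem hasTransvections_of_mem {A : Type u} [AddCommGroup A] [Module.Free ℤ A]
    (hA : ¬ Module.Finite ℤ A) {m : ℕ} {N : Subgroup (Module.End ℤ A)ˣ} [N.Normal]
    {f f' : Module.End ℤ A} (hf : f ∈ N.values) (hff : f * f' = 1) (hff' : f' * f = 1)
    {ι : Type v} {x y : ι → A} {k : ι → ℤ}
    (hinj : Function.Injective (Sum.elim x y))
    (huni : IsUnimodularSet (Set.range (Sum.elim x y)))
    (hcard : #(Set.range (Sum.elim x y)) = Module.rank ℤ A)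
    (hfx : ∀ i, f (x i) = k i • x i + m • y i) : N.HasTransvections m := by
  obtain ⟨-, T, hsub, hli, hspan⟩ := huni
  let b : Module.Basis T ℤ A := Module.Basis.mk hli (by
    rw [← hspan]
    exact Submodule.span_mono fun a ha => ⟨⟨a, ha⟩, rfl⟩)
  have hb : ∀ t : T, b t = t := fun t => Module.Basis.mk_apply _ _ t
  have hrank : #T = Module.rank ℤ A := b.mk_eq_rank''
  have : Infinite T := by
    rw [infinite_iff, hrank]
    exact aleph0_le_rank_of_not_finite hA
  -- Four disjoint blocks of pairs, each as large as a basis: blocks 0 and 1 serve as `x₁` and `x₂`,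
  -- block 2 gives the second summand, and block 3 is the spare room `z`.
  obtain ⟨F⟩ : Nonempty (Fin 4 × T ↪ ι) := by
    refine exists_embedding_fin_prod ?_
    have := mk_range_eq_of_injective hinj
    rw [mk_sum, hcard, ← hrank] at this
    simpa using this
  let X : Fin 4 → T → T := fun n t => ⟨x (F (n, t)), hsub ⟨Sum.inl _, rfl⟩⟩
  let Y : Fin 4 → T → T := fun n t => ⟨y (F (n, t)), hsub ⟨Sum.inr _, rfl⟩⟩
  have hXX : ∀ n t n' t', X n t = X n' t' → n = n' ∧ t = t' := fun n t n' t' h => by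
    have := F.injective (Sum.inl_injective (hinj (a₁ := Sum.inl _) (a₂ := Sum.inl _)
      (congrArg Subtype.val h)))
    exact Prod.mk.inj this
  have hYY : ∀ n t n' t', Y n t = Y n' t' → n = n' ∧ t = t' := fun n t n' t' h => by
    have := F.injective (Sum.inr_injective (hinj (a₁ := Sum.inr _) (a₂ := Sum.inr _)
      (congrArg Subtype.val h)))
    exact Prod.mk.inj this
  have hXY : ∀ n t n' t', X n t ≠ Y n' t' := fun n t n' t' h =>
    Sum.inl_ne_inr (hinj (a₁ := Sum.inl (F (n, t))) (a₂ := Sum.inr (F (n', t')))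
      (congrArg Subtype.val h))
  have hfX : ∀ n t, f (b (X n t)) = k (F (n, t)) • b (X n t) + m • b (Y n t) := fun n t => by
    rw [hb, hb]
    exact hfx _
  choose r hr hr0 using fun n => exists_retraction b (X n) fun t t' h => (hXX n t n t' h).2
  obtain ⟨q, hq, hq0⟩ := exists_retraction b (Y 1) fun t t' h => (hYY 1 t 1 t' h).2
  let I : Fin 4 → Module.End ℤ A := fun n => b.constr ℤ (b ∘ X n)
  have hI : ∀ n t, I n (b t) = b (X n t) := fun n t => b.constr_basis ℤ _ t
  have hrX : ∀ n n' t, n ≠ n' → r n (b (X n' t)) = 0 := fun n n' t hn =>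
    hr0 n _ fun ⟨t', ht'⟩ => hn (hXX _ _ _ _ ht').1
  have hrY : ∀ n n' t, r n (b (Y n' t)) = 0 := fun n n' t =>
    hr0 n _ fun ⟨t', ht'⟩ => hXY _ _ _ _ ht'
  have hqX : ∀ n t, q (b (X n t)) = 0 := fun n t =>
    hq0 _ fun ⟨t', ht'⟩ => hXY _ _ _ _ ht'.symm
  have hqY : ∀ n t, n ≠ 1 → q (b (Y n t)) = 0 := fun n t hn =>
    hq0 _ fun ⟨t', ht'⟩ => hn (hYY _ _ _ _ ht').1.symm
  have hrI : ∀ n, r n * I n = 1 := fun n => b.ext fun t => by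
    rw [Module.End.mul_apply, hI, hr, Module.End.one_apply]
  have hrI0 : ∀ n n', n ≠ n' → r n * I n' = 0 := fun n n' hn => b.ext fun t => by
    rw [Module.End.mul_apply, hI, hrX n n' t hn, LinearMap.zero_apply]
  have hrfI : ∀ n n', n ≠ n' → r n * (f * I n') = 0 := fun n n' hn => b.ext fun t => by
    rw [Module.End.mul_apply, Module.End.mul_apply, hI, hfX, map_add, map_smul, map_nsmul,
      hrX n n' t hn, hrY, smul_zero, smul_zero, add_zero, LinearMap.zero_apply]
  have hqI : ∀ n, q * I n = 0 := fun n => b.ext fun t => by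
    rw [Module.End.mul_apply, hI, hqX, LinearMap.zero_apply]
  have hqfI : q * (f * I 0) = 0 := b.ext fun t => by
    rw [Module.End.mul_apply, Module.End.mul_apply, hI, hfX, map_add, map_smul, map_nsmul,
      hqX, hqY 0 t (by decide), smul_zero, smul_zero, add_zero, LinearMap.zero_apply]
  have hqfI' : q * (f * I 1) = m • (1 : Module.End ℤ A) := b.ext fun t => by
    rw [Module.End.mul_apply, Module.End.mul_apply, hI, hfX, map_add, map_smul, map_nsmul,
      hqX, hq, smul_zero, zero_add, LinearMap.smul_apply, Module.End.one_apply]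
  -- Removing the block 3 component first makes the coordinates of `f' a` vanish on `I 3`, without
  -- changing them on `f * I n'`, which has no such component.
  have hc : ∀ n n', n' ≠ 3 → r n * f' * (1 - I 3 * r 3) * (f * I n') = r n * I n' := by
    intro n n' hn'
    rw [mul_assoc, sub_mul, mul_assoc (I 3), hrfI 3 n' hn'.symm, mul_zero, sub_zero, one_mul,
      mul_assoc, mul_mul_of_mul_eq hff', one_mul]
  have hz : ∀ n, r n * f' * (1 - I 3 * r 3) * I 3 = 0 := by
    intro n
    rw [mul_assoc, sub_mul, mul_assoc (I 3), hrI, mul_one, one_mul, sub_self, mul_zero]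
  refine hasTransvections_of_room hA (i₁ := f * I 0) (p₁ := r 0 * f' * (1 - I 3 * r 3))
    (i₂ := f * I 2) (p₂ := r 2 * f' * (1 - I 3 * r 3)) (w := r 3) (z := I 3)
    ?_ ?_ ?_ (hrI 3) (hz 0) (hz 2) fun h =>
    Subgroup.transvection_mem_values_of_unit hf hff hff' (hqI 0) (hqI 1) (hqI 3) hqfI hqfI'
      (hrI 3) (hrfI 3 0 (by decide)) ?_ ?_ h
  · rw [hc 0 0 (by decide), hrI]
  · rw [hc 2 2 (by decide), hrI]
  · rw [hc 2 0 (by decide), hrI0 2 0 (by decide)]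
  · rw [hc 2 0 (by decide), hrI0 2 0 (by decide)]
  · rw [hc 2 1 (by decide), hrI0 2 1 (by decide)]

end InfiniteRank

theorem mainTheorem5 {A : Type*} [AddCommGroup A] [Module.Free ℤ A]
    (hA : ¬ Module.Finite ℤ A) (m : ℕ) (hm : 2 ≤ m) (φ : A ≃ₗ[ℤ] A)
    {ι : Type*} (x y : ι → A) (k : ι → ℤ)
    (hinj : Function.Injective (Sum.elim x y))
    (huni : IsUnimodularSet (Set.range (Sum.elim x y)))
    (hcard : Cardinal.mk (Set.range (Sum.elim x y)) = Module.rank ℤ A)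
    (hφ : ∀ i, φ (x i) = k i • x i + m • y i) :
    principalCongruenceSubgroup A m ≤ Subgroup.normalClosure {φ} := by
  intro ψ hψ
  let e := LinearMap.GeneralLinearGroup.generalLinearEquiv ℤ A
  let N : Subgroup (Module.End ℤ A)ˣ := (Subgroup.normalClosure {φ}).comap e.toMonoidHom
  have hN : N.Normal := Subgroup.Normal.comap inferInstance _
  have hmem : ∀ χ : A ≃ₗ[ℤ] A, (χ : Module.End ℤ A) ∈ N.values ↔
      χ ∈ Subgroup.normalClosure {φ} := by
    intro χ
    have h : ((e.symm χ : (Module.End ℤ A)ˣ) : Module.End ℤ A) = χ := rfl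
    rw [← h, Subgroup.coe_mem_values, Subgroup.mem_comap]
    exact iff_of_eq (congrArg (· ∈ _) (e.apply_symm_apply χ))
  have hinv : ∀ χ : A ≃ₗ[ℤ] A, (χ : Module.End ℤ A) * (χ.symm : Module.End ℤ A) = 1 ∧
      (χ.symm : Module.End ℤ A) * (χ : Module.End ℤ A) = 1 := fun χ =>
    ⟨LinearMap.ext χ.apply_symm_apply, LinearMap.ext χ.symm_apply_apply⟩
  have hT : N.HasTransvections m := hasTransvections_of_mem hA
    ((hmem φ).2 (Subgroup.subset_normalClosure rfl)) (hinv φ).1 (hinv φ).2 hinj huni hcard hφ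
  choose g hg using hψ
  let b := Module.Free.chooseBasis ℤ A
  -- The chosen quotients `g a` need not depend linearly on `a`, so only their values on a basis are
  -- kept and extended linearly.
  refine (hmem ψ).1 (mem_values_of_eq_one_add hA hT (hinv ψ).1 (hinv ψ).2
    (g := b.constr ℤ fun t => g (b t)) (b.ext fun t => ?_))
  rw [LinearMap.add_apply, LinearMap.smul_apply, b.constr_basis, ← hg, Module.End.one_apply,
    add_sub_cancel]
  rfl
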